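/- Consider preemptive scheduling on a single machine. An instance consists of finitely many jobs $j$, each with a release date $r_j \ge 0$ and a processing time $p_j > 0$. A schedule is given by functions $y_j(t)$, the amount of processing that job $j$ has received until time $t$: each $y_j$ is nondecreasing, $y_j(t) = 0$ for $t \le r_j$, $y_j \le p_j$, and $\sum_j (y_j(t) - y_j(s)) \le t - s$ for all $s \le t$ (so the machine has unit speed and may share its processing power among jobs). The completion time $C_j$ is the earliest time $t$ with $y_j(t) = p_j$ ($C_j = \infty$ if there is none), the total flow time is $\sum_j (C_j - r_j)$, and $\mathrm{OPT}(I)$ is the minimum total flow time of a schedule for the instance $I$. For $\alpha \in [0,1)$, a deterministic $\alpha$-clairvoyant algorithm is an online algorithm which learns of the existence of a job $j$ only at time $r_j$, and learns $p_j$ only when the job emits its signal, that is, at the earliest time $t \ge r_j$ with $y_j(t) \ge \alpha p_j$; its schedule up to any time $T$ depends only on the information obtained before $T$. A randomized $\alpha$-clairvoyant algorithm is a random choice of a deterministic one (independent of the instance). Its competitive ratio is the smallest $\rho \in [0,\infty]$ such that on every instance $I$ its expected total flow time is at most $\rho \cdot \mathrm{OPT}(I)$. Theorem. There is an absolute constant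 $c > 0$ such that for every $\alpha \in [0,1)$, every randomized $\alpha$-clairvoyant algorithm for minimizing the total flow time on a single machine has competitive ratio at least $\frac{c}{1-\alpha}$. -/

import Mathlib

open MeasureTheory
open scoped ENNReal

namespace FlowTime

/-- An instance of single-machine scheduling with release dates: finitely many jobs, labelled by
natural numbers, each with a nonnegative release date and a positive processing time.
(The values of `release` and `proc` at labels outside `jobs` are irrelevant.) -/
structure Instance where
  jobs : Finset ℕ
  release : ℕ → ℝ
  proc : ℕ → ℝ
  release_nonneg : ∀ j ∈ jobs, 0 ≤ release j
  proc_pos : ∀ j ∈ jobs, 0 < proc j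

/-- `y j t` is the amount of processing that job `j` has received until time `t`. It is a feasible
preemptive schedule on one machine of unit speed (whose power may be shared among jobs). -/
structure IsSchedule (I : Instance) (y : ℕ → ℝ → ℝ) : Prop where
  mono : ∀ j, Monotone (y j)
  zero_of_notMem : ∀ j, j ∉ I.jobs → ∀ t, y j t = 0
  zero_of_le_release : ∀ j ∈ I.jobs, ∀ t, t ≤ I.release j → y j t = 0
  le_proc : ∀ j ∈ I.jobs, ∀ t, y j t ≤ I.proc j
  capacity : ∀ s t, s ≤ t → ∑ j ∈ I.jobs, (y j t - y j s) ≤ t - s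

/-- The completion time of job `j`: the earliest time at which it is fully processed
(`∞` if that never happens). -/
noncomputable def completionTime (I : Instance) (y : ℕ → ℝ → ℝ) (j : ℕ) : ℝ≥0∞ :=
  ⨅ (t : ℝ) (_ : y j t = I.proc j), ENNReal.ofReal t

/-- The sum over all jobs of completion time minus release date. -/
noncomputable def totalFlowTime (I : Instance) (y : ℕ → ℝ → ℝ) : ℝ≥0∞ :=
  ∑ j ∈ I.jobs, (completionTime I y j - ENNReal.ofReal (I.release j))

/-- The offline optimum. -/
noncomputable def opt (I : Instance) : ℝ≥0∞ :=
  ⨅ (y : ℕ → ℝ → ℝ) (_ : IsSchedule I y), totalFlowTime I y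

/-- Job `j` has been released by time `t`. -/
def Released (I : Instance) (j : ℕ) (t : ℝ) : Prop :=
  j ∈ I.jobs ∧ I.release j ≤ t

/-- Job `j` has emitted its signal by time `t`: it is released and an `α`-fraction of it has been
processed. -/
def Emitted (α : ℝ) (I : Instance) (y : ℕ → ℝ → ℝ) (j : ℕ) (t : ℝ) : Prop :=
  Released I j t ∧ α * I.proc j ≤ y j t

/-- What an `α`-clairvoyant scheduler knows at time `t` is the same in the run `y` on `I` and in the
run `y'` on `I'`: the same jobs are released, the same jobs have emitted, and the jobs that have
emitted have the same processing times. -/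
def SameInfo (α : ℝ) (I : Instance) (y : ℕ → ℝ → ℝ) (I' : Instance) (y' : ℕ → ℝ → ℝ)
    (t : ℝ) : Prop :=
  ∀ j, (Released I j t ↔ Released I' j t) ∧
    (Emitted α I y j t ↔ Emitted α I' y' j t) ∧
    (Emitted α I y j t → I.proc j = I'.proc j)

/-- A deterministic `α`-clairvoyant online algorithm: it produces a feasible schedule for every
instance, and its processing decisions up to time `T` depend only on what it has learned before
`T`. -/
structure Algorithm (α : ℝ) where
  schedule : Instance → ℕ → ℝ → ℝ
  feasible : ∀ I, IsSchedule I (schedule I)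
  online : ∀ (I I' : Instance) (T : ℝ),
    (∀ t < T, SameInfo α I (schedule I) I' (schedule I') t) →
      ∀ j, schedule I j T = schedule I' j T

/-- A randomized `α`-clairvoyant online algorithm: a random deterministic one, whose total flow time
on each fixed instance is a random variable. -/
structure RandomizedAlgorithm (α : ℝ) (Ω : Type*) [MeasurableSpace Ω] where
  law : Measure Ω
  isProbabilityMeasure : IsProbabilityMeasure law
  alg : Ω → Algorithm α
  measurable_flow : ∀ I, Measurable fun ω => totalFlowTime I ((alg ω).schedule I)



/-- The expected total flow time on a fixed instance. -/
noncomputable def RandomizedAlgorithm.expectedFlowTime {α : ℝ} {Ω : Type*}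
    [MeasurableSpace Ω] (A : RandomizedAlgorithm α Ω)
    (I : Instance) : ℝ≥0∞ :=
  ∫⁻ ω, totalFlowTime I ((A.alg ω).schedule I) ∂A.law

/-- The algorithm is `ρ`-competitive. -/
def RandomizedAlgorithm.IsCompetitive {α : ℝ} {Ω : Type*}
    [MeasurableSpace Ω] (A : RandomizedAlgorithm α Ω) (ρ : ℝ≥0∞) : Prop :=
  ∀ I, A.expectedFlowTime I ≤ ρ * opt I

/-- The smallest `ρ` such that the algorithm is `ρ`-competitive. -/
noncomputable def RandomizedAlgorithm.competitiveRatio {α : ℝ} {Ω : Type*}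
    [MeasurableSpace Ω] (A : RandomizedAlgorithm α Ω) : ℝ≥0∞ :=
  sInf {ρ | A.IsCompetitive ρ}

end FlowTime

/-! By Yao's principle it suffices to exhibit a random instance on which every deterministic
algorithm has mean flow time at least of order `1 / (1 - α)` times the mean optimum. Put `m = ⌊1 /
(1 - α)⌋`. At time `0` release `n` jobs with independent sizes, geometric with parameter `1/2` and
truncated at `m + 1`. From `T`, the mean volume of the jobs of non-maximal size, send a long stream
of `M` unit jobs, so that the backlog left at `T` is paid for throughout the stream.

The algorithm: before its signal a job reveals only that it is not too short, and the geometric law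
is nearly memoryless, so its mean remaining work is `O(1)`; after the signal at most `(1 - α) (m +
1) ≤ 2` remains. Hence expected remaining work is at most three times the expected number of
unfinished jobs (`sum_geomWeight_remaining_le`). The backlog has mean volume at least `n 2⁻ᵐ (m +
1)` during the stream, so on average at least a third of that many jobs are waiting
(`le_prodExp_unfinished`).

The optimum: finish the small jobs by `T`, except for `O(√n)` of them on average because of
fluctuations, and postpone the about `n 2⁻ᵐ` maximal ones past the stream
(`sum_opt_hardInstance_le`). With `n = 4 ^ (m + 1)` both numbers are of order `2 ^ m`, and the ratio
is of order `m + 1`. -/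

namespace FlowTime

open Set Filter Topology

/-! ### Feasible schedules, and runs that an online algorithm cannot distinguish -/

section Schedule

variable {I : Instance} {y : ℕ → ℝ → ℝ}

theorem IsSchedule.nonneg (h : IsSchedule I y) (j : ℕ) (t : ℝ) : 0 ≤ y j t := by
  by_cases hj : j ∈ I.jobs
  · have h0 := h.zero_of_le_release j hj (min t (I.release j)) (min_le_right _ _)
    rw [← h0]
    exact h.mono j (min_le_left _ _)
  · exact (h.zero_of_notMem j hj t).ge

theorem IsSchedule.zero_of_nonpos (h : IsSchedule I y) (j : ℕ) {t : ℝ} (ht : t ≤ 0) :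
    y j t = 0 := by
  by_cases hj : j ∈ I.jobs
  · exact h.zero_of_le_release j hj t (ht.trans (I.release_nonneg j hj))
  · exact h.zero_of_notMem j hj t

theorem IsSchedule.sub_le (h : IsSchedule I y) (j : ℕ) {s t : ℝ} (hst : s ≤ t) :
    y j t - y j s ≤ t - s := by
  by_cases hj : j ∈ I.jobs
  · refine le_trans ?_ (h.capacity s t hst)
    exact Finset.single_le_sum (f := fun j => y j t - y j s)
      (fun i _ => sub_nonneg.2 (h.mono i hst)) hj
  · simp [h.zero_of_notMem j hj, hst]

theorem IsSchedule.continuous (h : IsSchedule I y) (j : ℕ) : Continuous (y j) := by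
  refine (LipschitzWith.of_le_add fun s t => ?_).continuous
  rcases le_total s t with hst | hst
  · exact (h.mono j hst).trans (le_add_of_nonneg_right dist_nonneg)
  · have := h.sub_le j hst
    rw [Real.dist_eq, abs_of_nonneg (sub_nonneg.2 hst)]
    linarith

/-- A job that is not yet finished at time `t` completes at time `t` at the earliest. -/
theorem IsSchedule.le_completionTime (h : IsSchedule I y) {j : ℕ} {t : ℝ} (ht : y j t < I.proc j) :
    ENNReal.ofReal t ≤ completionTime I y j := by
  refine le_iInf₂ fun u hu => ENNReal.ofReal_le_ofReal ?_
  by_contra! hut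
  exact absurd (h.mono j hut.le) (by rw [hu]; exact not_le.2 ht)

end Schedule

/-- If two instances differ only in the processing time of the job `j`, then the runs of an
`α`-clairvoyant algorithm on them agree as long as `j` has emitted its signal in neither. -/
theorem Algorithm.schedule_eq_of_not_emitted {α : ℝ} (A : Algorithm α) {I I' : Instance} {j : ℕ}
    (hjobs : I.jobs = I'.jobs) (hrel : I.release = I'.release)
    (hproc : ∀ i ≠ j, I.proc i = I'.proc i) {t : ℝ} (ht : 0 ≤ t)
    (h : A.schedule I j t < α * I.proc j) (h' : A.schedule I j t < α * I'.proc j) (i : ℕ) :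
    A.schedule I i t = A.schedule I' i t := by
  have hS := A.feasible I
  have hS' := A.feasible I'
  have key : t ∈ {x | ∀ u ≤ x, ∀ i, A.schedule I i u = A.schedule I' i u} := by
    -- Induction along the real line: the times up to which the runs agree form a closed set that
    -- can always be extended to the right.
    refine IsClosed.mem_of_ge_of_forall_exists_gt (a := 0) ?_ ?_ ht ?_
    · refine IsClosed.inter ?_ isClosed_Icc
      rw [← isOpen_compl_iff, isOpen_iff_mem_nhds]
      intro x hx
      simp only [mem_compl_iff, mem_ofPred_eq, not_forall] at hx
      obtain ⟨u, hux, i, hi⟩ := hx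
      have hev : ∀ᶠ v in 𝓝 u, A.schedule I i v ≠ A.schedule I' i v :=
        ((hS.continuous i).continuousAt.ne_iff_eventually_ne (hS'.continuous i).continuousAt).1 hi
      -- Moving the disagreement to some `v < u` matters when `u = x`: only then do points slightly
      -- left of `x` also see it.
      obtain ⟨v, hv, hvu⟩ := ((hev.filter_mono nhdsWithin_le_nhds).and
        (self_mem_nhdsWithin : Iio u ∈ 𝓝[<] u)).exists
      filter_upwards [Ioi_mem_nhds (lt_of_lt_of_le hvu hux)] with z hz hz'
      exact hv (hz' v (le_of_lt hz) i)
    · intro u hu i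
      rw [hS.zero_of_nonpos i hu, hS'.zero_of_nonpos i hu]
    · rintro x ⟨hx, -, hxt⟩
      -- Agreement just after `x` is not yet known, so signals there are controlled in each run
      -- separately: by continuity a missing signal stays missing for a while, and by monotonicity
      -- an emitted one stays emitted.
      have hev : ∀ᶠ u in 𝓝 x, ∀ i ∈ I.jobs, (A.schedule I i x < α * I.proc i →
          A.schedule I i u < α * I.proc i) ∧ (A.schedule I' i x < α * I'.proc i →
          A.schedule I' i u < α * I'.proc i) := by
        rw [Filter.eventually_all_finset]
        intro i _
        refine Filter.Eventually.and ?_ ?_ <;> rw [Filter.eventually_imp_distrib_left] <;>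
          intro hlt
        · exact (hS.continuous i).continuousAt.eventually_lt continuousAt_const hlt
        · exact (hS'.continuous i).continuousAt.eventually_lt continuousAt_const hlt
      obtain ⟨z, hxz, hz⟩ := mem_nhdsGE_iff_exists_Ico_subset.1
        (mem_nhdsWithin_of_mem_nhds hev : _ ∈ 𝓝[≥] x)
      have hxz : x < z := hxz
      refine ⟨min z t, ?_, lt_min hxz hxt, min_le_right _ _⟩
      intro v hv
      refine A.online I I' v fun u hu => ?_
      have huz : u < z := hu.trans_le (hv.trans (min_le_left _ _))
      have hut : u < t := hu.trans_le (hv.trans (min_le_right _ _))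
      have hR : ∀ i, Released I i u ↔ Released I' i u := by
        intro i; simp [Released, hjobs, hrel]
      have hE : ∀ i ∈ I.jobs, (α * I.proc i ≤ A.schedule I i u ↔
          α * I'.proc i ≤ A.schedule I' i u) ∧ (i = j → A.schedule I i u < α * I.proc i) := by
        intro i hi
        have hj1 : i = j → A.schedule I i u < α * I.proc i := by
          rintro rfl
          exact (hS.mono _ hut.le).trans_lt h
        refine ⟨?_, hj1⟩
        have hxi := hx x le_rfl i
        have hj2 : i = j → A.schedule I' i x < α * I'.proc i := by
          rintro rfl
          rw [← hxi]
          exact (hS.mono _ hxt.le).trans_lt h'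
        rcases lt_or_ge u x with hux | hux
        · rw [← hx u hux.le i]
          by_cases hij : i = j
          · refine iff_of_false (not_le.2 (hj1 hij)) (not_le.2 ?_)
            rw [hx u hux.le i]
            exact (hS'.mono i hux.le).trans_lt (hj2 hij)
          · rw [hproc i hij]
        · obtain ⟨h1, h2⟩ := hz ⟨hux, huz⟩ i hi
          by_cases hij : i = j
          · exact iff_of_false (not_le.2 (hj1 hij)) (not_le.2 (h2 (hj2 hij)))
          · rcases lt_or_ge (A.schedule I i x) (α * I.proc i) with hlt | hge
            · refine iff_of_false (not_le.2 (h1 hlt)) (not_le.2 (h2 ?_))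
              rwa [← hproc i hij, ← hxi]
            · refine iff_of_true (hge.trans (hS.mono i hux)) ?_
              rw [← hproc i hij]
              exact (hge.trans hxi.le).trans (hS'.mono i hux)
      intro i
      refine ⟨hR i, ?_, ?_⟩
      · unfold Emitted
        rw [← hR i]
        exact and_congr_right fun hr => (hE i hr.1).1
      · rintro ⟨hr, he⟩
        refine hproc i fun hij => ?_
        exact absurd ((hE i hr.1).2 hij) (not_lt.2 he)
  exact key t le_rfl i

end FlowTime

namespace FlowTime

/-! ### Expectations over independent coordinates -/

section ProductWeights

variable {ι κ : Type*} [Fintype ι] [DecidableEq ι] [Fintype κ]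

/-- The expectation of `F` when the coordinates are drawn independently with weights `w`. -/
noncomputable def prodExp (w : κ → ℝ) (F : (ι → κ) → ℝ) : ℝ :=
  ∑ f : ι → κ, (∏ i, w (f i)) * F f

variable {w : κ → ℝ}

theorem prodExp_mono (hw : ∀ k, 0 ≤ w k) {F G : (ι → κ) → ℝ} (h : ∀ f, F f ≤ G f) :
    prodExp w F ≤ prodExp w G :=
  Finset.sum_le_sum fun f _ =>
    mul_le_mul_of_nonneg_left (h f) (Finset.prod_nonneg fun i _ => hw (f i))

theorem prodExp_add (F G : (ι → κ) → ℝ) :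
    prodExp w (fun f => F f + G f) = prodExp w F + prodExp w G := by
  simp [prodExp, mul_add, Finset.sum_add_distrib]

theorem prodExp_const_mul (c : ℝ) (F : (ι → κ) → ℝ) :
    prodExp w (fun f => c * F f) = c * prodExp w F := by
  simp only [prodExp, Finset.mul_sum]
  exact Finset.sum_congr rfl fun f _ => by ring

theorem prodExp_sum {β : Type*} (s : Finset β) (F : β → (ι → κ) → ℝ) :
    prodExp w (fun f => ∑ b ∈ s, F b f) = ∑ b ∈ s, prodExp w (F b) := by
  simp only [prodExp, Finset.mul_sum]
  exact Finset.sum_comm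

theorem prodExp_const (hw : ∑ k, w k = 1) (c : ℝ) :
    prodExp w (fun _ : ι → κ => c) = c := by
  have h := Finset.prod_univ_sum (fun _ : ι => (Finset.univ : Finset κ)) (fun _ k => w k)
  simp only [hw, Finset.prod_const_one, Fintype.piFinset_univ] at h
  rw [prodExp, ← Finset.sum_mul, ← h, one_mul]

/-- Resampling one coordinate does not change the expectation. -/
theorem prodExp_resample (hw : ∑ k, w k = 1) (i : ι) (F : (ι → κ) → ℝ) :
    prodExp w F = prodExp w fun f => ∑ k, w k * F (Function.update f i k) := by
  classical
  -- Fubini: sum over coordinate `i` first, with the other coordinates `g` fixed.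
  have split : ∀ G : (ι → κ) → ℝ, prodExp w G = ∑ g : {j // j ≠ i} → κ, (∏ j, w (g j)) *
      ∑ k, w k * G ((Equiv.funSplitAt i κ).symm (k, g)) := by
    intro G
    rw [prodExp, ← (Equiv.funSplitAt i κ).symm.sum_comp, Fintype.sum_prod_type, Finset.sum_comm]
    refine Finset.sum_congr rfl fun g _ => ?_
    rw [Finset.mul_sum]
    refine Finset.sum_congr rfl fun k _ => ?_
    have : ∏ j, w ((Equiv.funSplitAt i κ).symm (k, g) j) = w k * ∏ j, w (g j) := by
      rw [Fintype.prod_eq_mul_prod_subtype_ne _ i]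
      congr 1
      · simp
      · exact Finset.prod_congr rfl fun j _ => by simp [j.2]
    rw [this]
    ring
  rw [split F, split]
  refine Finset.sum_congr rfl fun g _ => ?_
  congr 1
  have : ∀ k k', Function.update ((Equiv.funSplitAt i κ).symm (k, g)) i k' =
      (Equiv.funSplitAt i κ).symm (k', g) := by
    intro k k'
    ext j
    by_cases h : j = i
    · subst h; simp
    · simp [h]
  simp only [this]
  rw [← Finset.sum_mul, hw, one_mul]

theorem prodExp_coord (hw : ∑ k, w k = 1) (i : ι) (g : κ → ℝ) :
    prodExp w (fun f : ι → κ => g (f i)) = ∑ k, w k * g k := by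
  rw [prodExp_resample hw i]
  simp [prodExp_const hw]

/-- The second moment of a sum of independent centred variables is the sum of the second
moments. -/
theorem prodExp_sq_sum (hw : ∑ k, w k = 1) (g : κ → ℝ) (hg : ∑ k, w k * g k = 0) :
    prodExp w (fun f : ι → κ => (∑ i, g (f i)) ^ 2) =
      Fintype.card ι * ∑ k, w k * g k ^ 2 := by
  simp only [pow_two (∑ i, g _), Finset.sum_mul_sum]
  rw [prodExp_sum]
  have : ∀ i : ι, prodExp w (fun f : ι → κ => ∑ j, g (f i) * g (f j)) = ∑ k, w k * g k ^ 2 := by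
    intro i
    rw [prodExp_sum, Finset.sum_eq_single i]
    · rw [← prodExp_coord hw i]
      simp only [pow_two]
    · intro j _ hj
      rw [prodExp_resample hw i]
      simp only [Function.update_self, Function.update_of_ne hj, ← mul_assoc, ← Finset.sum_mul, hg]
      simp [prodExp]
    · simp
  simp [this]

end ProductWeights

/-! ### The truncated geometric distribution -/

section Geometric

/-- The geometric distribution with parameter `1/2`, truncated at `m`. -/
noncomputable def geomWeight (m k : ℕ) : ℝ := if k < m then (1 / 2) ^ (k + 1) else (1 / 2) ^ m

theorem geomWeight_nonneg (m k : ℕ) : 0 ≤ geomWeight m k := by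
  unfold geomWeight; split_ifs <;> positivity

theorem geomWeight_self (m : ℕ) : geomWeight m m = (1 / 2) ^ m := by simp [geomWeight]

theorem sum_Ico_geomWeight (m d : ℕ) (hd : d ≤ m) :
    ∑ k ∈ Finset.Ico (m - d) (m + 1), geomWeight m k = (1 / 2) ^ (m - d) := by
  induction d with
  | zero => simp [geomWeight_self]
  | succ d ih =>
    rw [Finset.sum_eq_sum_Ico_succ_bot (by omega), show m - (d + 1) + 1 = m - d by omega,
      ih (by omega), geomWeight, if_pos (by omega), show m - (d + 1) + 1 = m - d by omega,
      show m - d = m - (d + 1) + 1 by omega]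
    ring

/-- Lowering the level by one adds the tail mass above the new level and subtracts the weight of the
new bottom atom. These are equal, so the value stays that of the top atom. -/
theorem sum_Ico_geomWeight_mul (m d : ℕ) (hd : d ≤ m) :
    ∑ k ∈ Finset.Ico (m - d) (m + 1), geomWeight m k * ((k : ℝ) - (m - d : ℕ) - 1) =
      -(1 / 2) ^ m := by
  induction d with
  | zero => simp [geomWeight_self]
  | succ d ih =>
    have h : ∀ k : ℕ, geomWeight m k * ((k : ℝ) - (m - (d + 1) : ℕ) - 1) =
        geomWeight m k * ((k : ℝ) - (m - d : ℕ) - 1) + geomWeight m k := by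
      intro k
      rw [show m - d = m - (d + 1) + 1 by omega]
      push_cast
      ring
    rw [Finset.sum_eq_sum_Ico_succ_bot (by omega), show m - (d + 1) + 1 = m - d by omega]
    simp only [h (_ : ℕ)]
    rw [Finset.sum_add_distrib, ih (by omega), sum_Ico_geomWeight m d (by omega), geomWeight,
      if_pos (by omega), show m - d = m - (d + 1) + 1 by omega]
    push_cast
    ring

theorem sum_geomWeight (m : ℕ) : ∑ k : Fin (m + 1), geomWeight m k = 1 := by
  rw [Fin.sum_univ_eq_sum_range (geomWeight m)]
  simpa using sum_Ico_geomWeight m m le_rfl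

/-- Almost memorylessness: the mean excess over any level `a ≤ m` is at most `1`. -/
theorem sum_geomWeight_excess_le (m a : ℕ) (ha : a ≤ m) :
    ∑ k : Fin (m + 1), (if a ≤ (k : ℕ) then geomWeight m k * ((k : ℝ) - a - 1) else 0) ≤ 0 := by
  rw [Fin.sum_univ_eq_sum_range
    (fun k => if a ≤ k then geomWeight m k * ((k : ℝ) - a - 1) else 0), ← Finset.sum_filter]
  have : (Finset.range (m + 1)).filter (fun k => a ≤ k) = Finset.Ico a (m + 1) := by
    ext k; simp; omega
  have h := sum_Ico_geomWeight_mul m (m - a) (by omega)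
  rw [show m - (m - a) = a by omega] at h
  rw [this, h]
  simp

theorem sum_geomWeight_sq_le (m : ℕ) :
    ∑ k : Fin (m + 1), geomWeight m k * (if (k : ℕ) < m then (k : ℝ) + 1 else 0) ^ 2 ≤ 6 := by
  rw [Fin.sum_univ_eq_sum_range
    (fun k => geomWeight m k * (if k < m then (k : ℝ) + 1 else 0) ^ 2), Finset.sum_range_succ]
  -- `6` is the second moment of the untruncated geometric law; the subtracted term is its tail.
  have h : ∀ l : ℕ, ∑ k ∈ Finset.range l, ((1 : ℝ) / 2) ^ (k + 1) * ((k : ℝ) + 1) ^ 2 =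
      6 - ((l : ℝ) ^ 2 + 4 * l + 6) * (1 / 2) ^ l := by
    intro l
    induction l with
    | zero => simp
    | succ l ih =>
      rw [Finset.sum_range_succ, ih]
      push_cast
      ring
  rw [Finset.sum_congr rfl (g := fun k : ℕ => ((1 : ℝ) / 2) ^ (k + 1) * ((k : ℝ) + 1) ^ 2), h]
  · have : 0 ≤ ((m : ℝ) ^ 2 + 4 * m + 6) * (1 / 2) ^ m := by positivity
    simpa using this
  · intro k hk
    simp [geomWeight, Finset.mem_range.1 hk]

end Geometric

end FlowTime

namespace FlowTime

/-! ### Flow time as the integral of the number of unfinished jobs -/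

section Unfinished

open Classical in
/-- The number of jobs that are released but unfinished at time `t`. -/
noncomputable def unfinished (I : Instance) (y : ℕ → ℝ → ℝ) (t : ℝ) : ℝ :=
  ∑ j ∈ I.jobs, if I.release j ≤ t ∧ y j t < I.proc j then 1 else 0

theorem unfinished_nonneg (I : Instance) (y : ℕ → ℝ → ℝ) (t : ℝ) : 0 ≤ unfinished I y t :=
  Finset.sum_nonneg fun j _ => by split_ifs <;> norm_num

theorem measurableSet_unfinished {I : Instance} {y : ℕ → ℝ → ℝ} (h : IsSchedule I y) (j : ℕ) :
    MeasurableSet {t | I.release j ≤ t ∧ y j t < I.proc j} :=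
  measurableSet_Ici.inter (measurableSet_lt (h.continuous j).measurable measurable_const)

theorem measurable_unfinished {I : Instance} {y : ℕ → ℝ → ℝ} (h : IsSchedule I y) :
    Measurable (unfinished I y) := by
  unfold unfinished
  refine Finset.measurable_fun_sum _ fun j _ => ?_
  exact Measurable.ite (measurableSet_unfinished h j) measurable_const measurable_const

/-- The total flow time is at least the time integral of the number of unfinished jobs. -/
theorem lintegral_unfinished_le {I : Instance} {y : ℕ → ℝ → ℝ} (h : IsSchedule I y) (s : Set ℝ) :
    ∫⁻ t in s, ENNReal.ofReal (unfinished I y t) ≤ totalFlowTime I y := by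
  classical
  have heq : ∀ t, ENNReal.ofReal (unfinished I y t) =
      ∑ j ∈ I.jobs, {t | I.release j ≤ t ∧ y j t < I.proc j}.indicator 1 t := by
    intro t
    rw [unfinished, ENNReal.ofReal_sum_of_nonneg (fun j _ => by split_ifs <;> simp)]
    refine Finset.sum_congr rfl fun j _ => ?_
    simp only [Set.indicator, Set.mem_ofPred_eq]
    split_ifs <;> simp
  simp only [heq]
  rw [lintegral_finsetSum _
    fun j _ => measurable_one.indicator (measurableSet_unfinished h j)]
  refine Finset.sum_le_sum fun j hj => ?_
  refine (setLIntegral_le_lintegral _ _).trans ?_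
  rw [lintegral_indicator_one (measurableSet_unfinished h j)]
  by_cases hC : completionTime I y j = ⊤
  · simp [hC]
  · rw [← ENNReal.ofReal_toReal hC, ← ENNReal.ofReal_sub _ (I.release_nonneg j hj),
      ← Real.volume_Icc]
    refine measure_mono ?_
    rintro t ⟨hrt, ht⟩
    exact ⟨hrt, (ENNReal.ofReal_le_iff_le_toReal hC).1 (h.le_completionTime ht)⟩

end Unfinished

/-! ### Remaining work of one job of random size -/

section Remaining

/-- Averaged over its truncated geometric size `k + 1`, a job that received `Y k` has remaining
work at most three times the probability that it is unfinished. -/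
theorem sum_geomWeight_remaining_le {m : ℕ} {α : ℝ} (hα0 : 0 ≤ α) (hα1 : α ≤ 1)
    (hm : (1 - α) * m ≤ 1) (Y : Fin (m + 1) → ℝ) (hY0 : ∀ k, 0 ≤ Y k)
    (hsame : ∀ k k' : Fin (m + 1), Y k < α * ((k : ℝ) + 1) → Y k < α * ((k' : ℝ) + 1) →
      Y k = Y k') :
    ∑ k : Fin (m + 1), geomWeight m k * ((k : ℝ) + 1 - Y k) ≤
      ∑ k : Fin (m + 1), geomWeight m k * (3 * if Y k < (k : ℝ) + 1 then 1 else 0) := by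
  -- After the signal at most `(1 - α) (k + 1) ≤ (1 - α) m + (1 - α) ≤ 2` is left.
  have hsig : ∀ k : Fin (m + 1), α * ((k : ℝ) + 1) ≤ Y k →
      (k : ℝ) + 1 - Y k ≤ 3 * if Y k < (k : ℝ) + 1 then 1 else 0 := by
    intro k hk
    split_ifs with h
    · have hkm : (k : ℝ) ≤ m := by exact_mod_cast Nat.le_of_lt_succ k.2
      have := mul_le_mul_of_nonneg_left hkm (sub_nonneg.2 hα1)
      linarith
    · linarith
  by_cases hex : ∃ k : Fin (m + 1), Y k < α * ((k : ℝ) + 1)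
  -- `a` is the least index whose job is still silent; all larger ones are then silent too and have
  -- received the same amount `Y a`.
  · obtain ⟨a, ha, hmin⟩ := (Set.toFinite {k | Y k < α * ((k : ℝ) + 1)}).exists_minimal hex
    have ha : Y a < α * ((a : ℝ) + 1) := ha
    have hlt : ∀ k, k < a → α * ((k : ℝ) + 1) ≤ Y k := by
      intro k hka
      by_contra! hk
      exact absurd (hmin (show k ∈ {k | Y k < α * ((k : ℝ) + 1)} from hk) hka.le) (not_le.2 hka)
    have hge : ∀ k, a ≤ k → Y k = Y a := by
      intro k hak
      refine (hsame a k ha (ha.trans_le ?_)).symm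
      have : (a : ℝ) ≤ k := by exact_mod_cast hak
      gcongr
    -- Otherwise size `a` would be indistinguishable from size `a + 1`, although its index `a - 1`
    -- has signalled.
    have hYa : α * a ≤ Y a := by
      by_contra! hc
      have hapos : (a : ℕ) ≠ 0 := by
        intro h0
        rw [h0] at hc
        simp only [Nat.cast_zero, mul_zero] at hc
        exact absurd (hY0 a) (not_le.2 hc)
      let b : Fin (m + 1) := ⟨a - 1, by omega⟩
      have hb : ((b : ℕ) : ℝ) + 1 = a := by
        have : (b : ℕ) + 1 = a := by simp only [b]; omega
        exact_mod_cast this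
      have hba : b < a := by
        rw [Fin.lt_def]; simp only [b]; omega
      have := hsame a b ha (by rwa [hb])
      have h2 := hlt b hba
      rw [hb, ← this] at h2
      linarith
    have ham : (a : ℝ) ≤ m := by exact_mod_cast Nat.le_of_lt_succ a.2
    -- For silent jobs `k + 1 - Y a ≤ (k - a - 1) + 2 + (1 - α) a`, and the last two summands give
    -- at most `3`. The mean of `k - a - 1` over the tail is nonpositive.
    have hterm : ∀ k : Fin (m + 1), geomWeight m k * ((k : ℝ) + 1 - Y k) ≤
        geomWeight m k * (3 * if Y k < (k : ℝ) + 1 then 1 else 0) +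
          if (a : ℕ) ≤ (k : ℕ) then geomWeight m k * ((k : ℝ) - (a : ℕ) - 1) else 0 := by
      intro k
      have hw := geomWeight_nonneg m k
      split_ifs with h1 h2 h2
      · rw [← mul_add]
        refine mul_le_mul_of_nonneg_left ?_ hw
        rw [hge k h2]
        have := mul_le_mul_of_nonneg_left ham (sub_nonneg.2 hα1)
        linarith
      · rw [add_zero]
        refine mul_le_mul_of_nonneg_left ?_ hw
        simpa [h1] using hsig k (hlt k (by rw [Fin.lt_def]; omega))
      · exfalso
        rw [hge k h2] at h1
        have : (a : ℝ) ≤ k := by exact_mod_cast h2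
        have := mul_le_mul_of_nonneg_right hα1 (show (0 : ℝ) ≤ (a : ℝ) + 1 by positivity)
        linarith
      · rw [add_zero]
        refine mul_le_mul_of_nonneg_left ?_ hw
        simpa [h1] using hsig k (hlt k (by rw [Fin.lt_def]; omega))
    refine (Finset.sum_le_sum fun k _ => hterm k).trans ?_
    rw [Finset.sum_add_distrib]
    have := sum_geomWeight_excess_le m a (Nat.le_of_lt_succ a.2)
    linarith
  · push Not at hex
    exact Finset.sum_le_sum fun k _ =>
      mul_le_mul_of_nonneg_left (hsig k (hex k)) (geomWeight_nonneg m k)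

end Remaining

/-! ### The hard instance and the backlog of an online algorithm -/

section HardInstance

/-- Jobs `i < n` of size `f i + 1` are released at time `0`, followed by `M` unit jobs released
one by one at times `T, T + 1, …`. -/
noncomputable def hardInstance {n m : ℕ} (M : ℕ) {T : ℝ} (hT : 0 ≤ T) (f : Fin n → Fin (m + 1)) :
    Instance where
  jobs := Finset.range (n + M)
  release j := if j < n then 0 else T + (j - n : ℕ)
  proc j := if h : j < n then ((f ⟨j, h⟩ : ℕ) : ℝ) + 1 else 1
  release_nonneg j _ := by split_ifs <;> positivity
  proc_pos j _ := by split_ifs <;> positivity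

variable {n m M : ℕ} {T : ℝ} {hT : 0 ≤ T} {f : Fin n → Fin (m + 1)}

theorem hardInstance_release_coe (i : Fin n) : (hardInstance M hT f).release i = 0 := by
  simp [hardInstance]

theorem hardInstance_proc_coe (i : Fin n) : (hardInstance M hT f).proc i = (f i : ℝ) + 1 := by
  simp [hardInstance]

theorem hardInstance_release_add (l : ℕ) : (hardInstance M hT f).release (n + l) = T + l := by
  simp [hardInstance]

theorem hardInstance_proc_add (l : ℕ) : (hardInstance M hT f).proc (n + l) = 1 := by
  simp [hardInstance]

theorem sum_hardInstance_jobs {β : Type*} [AddCommMonoid β] (g : ℕ → β) :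
    ∑ j ∈ (hardInstance M hT f).jobs, g j = ∑ i : Fin n, g i + ∑ l ∈ Finset.range M, g (n + l) := by
  rw [Fin.sum_univ_eq_sum_range]
  exact Finset.sum_range_add _ _ _

open Classical in
theorem unfinished_hardInstance (y : ℕ → ℝ → ℝ) {t : ℝ} (ht : 0 ≤ t) :
    unfinished (hardInstance M hT f) y t =
      ∑ i : Fin n, (if y i t < (f i : ℝ) + 1 then 1 else 0) +
        ∑ l ∈ Finset.range M, if T + l ≤ t ∧ y (n + l) t < 1 then 1 else 0 := by
  rw [unfinished, sum_hardInstance_jobs]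
  simp only [hardInstance_release_coe, hardInstance_proc_coe, hardInstance_release_add,
    hardInstance_proc_add, ht, true_and]

open Classical in
/-- While the unit jobs arrive, the volume of the unfinished work does not decrease below its value
at time `T`. -/
theorem volume_sub_le_remaining {y : ℕ → ℝ → ℝ} (h : IsSchedule (hardInstance M hT f) y) {t : ℝ}
    (hTt : T ≤ t) (htM : t < T + M) :
    ∑ i : Fin n, ((f i : ℝ) + 1) - T ≤ ∑ i : Fin n, ((f i : ℝ) + 1 - y i t) +
      ∑ l ∈ Finset.range M, if T + l ≤ t ∧ y (n + l) t < 1 then 1 else 0 := by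
  have ht : 0 ≤ t := hT.trans hTt
  have hcap := h.capacity 0 t ht
  simp only [h.zero_of_nonpos _ le_rfl, sub_zero] at hcap
  rw [sum_hardInstance_jobs] at hcap
  -- An unfinished unit job has at most `1` unit of work left, so work is bounded by count.
  have hl : ∀ l ∈ Finset.range M, (if T + (l : ℝ) ≤ t then (1 : ℝ) else 0) - y (n + l) t ≤
      if T + (l : ℝ) ≤ t ∧ y (n + l) t < 1 then 1 else 0 := by
    intro l _
    have := h.nonneg (n + l) t
    split_ifs with h1 h2 h2
    · linarith
    · have : 1 ≤ y (n + l) t := not_lt.1 fun h3 => h2 ⟨h1, h3⟩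
      linarith
    · exact absurd h2.1 h1
    · linarith
  -- The stream releases `⌊t - T⌋₊ + 1` jobs by time `t`, the first one at `T` itself, so it
  -- replaces all the work the machine can do after `T`.
  have hcount : t - T ≤ ∑ l ∈ Finset.range M, (if T + (l : ℝ) ≤ t then (1 : ℝ) else 0) := by
    rw [Finset.sum_boole]
    have hfl : ⌊t - T⌋₊ < M := (Nat.floor_lt (by linarith)).2 (by linarith)
    have hsub : Finset.range (⌊t - T⌋₊ + 1) ⊆
        (Finset.range M).filter fun l : ℕ => T + (l : ℝ) ≤ t := by
      intro l hl
      rw [Finset.mem_range] at hl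
      have : (l : ℝ) ≤ t - T :=
        (Nat.cast_le.2 (Nat.le_of_lt_succ hl)).trans (Nat.floor_le (by linarith))
      rw [Finset.mem_filter, Finset.mem_range]
      exact ⟨by omega, by linarith⟩
    have hc := Finset.card_le_card hsub
    rw [Finset.card_range] at hc
    refine (Nat.lt_floor_add_one (t - T)).le.trans ?_
    exact_mod_cast hc
  have hs := Finset.sum_le_sum hl
  rw [Finset.sum_sub_distrib] at hs ⊢
  linarith

variable {α : ℝ}

/-- Fix the sizes of all jobs but `i` and resample that of `i`: the resulting instances differ only
in one processing time, so their runs agree while job `i` is silent, and the bound for a single job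
applies. -/
theorem prodExp_remaining_le (A : Algorithm α) (hα0 : 0 ≤ α) (hα1 : α ≤ 1)
    (hm : (1 - α) * m ≤ 1) {t : ℝ} (ht : 0 ≤ t) (i : Fin n) :
    prodExp (fun k : Fin (m + 1) => geomWeight m k)
        (fun f : Fin n → Fin (m + 1) =>
          (f i : ℝ) + 1 - A.schedule (hardInstance M hT f) i t) ≤
      prodExp (fun k : Fin (m + 1) => geomWeight m k)
        (fun f : Fin n → Fin (m + 1) =>
          3 * if A.schedule (hardInstance M hT f) i t < (f i : ℝ) + 1 then 1 else 0) := by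
  have hw1 : ∑ k : Fin (m + 1), geomWeight m k = 1 := sum_geomWeight m
  rw [prodExp_resample hw1 i, prodExp_resample hw1 i fun f : Fin n → Fin (m + 1) => 3 * _]
  refine prodExp_mono (fun k : Fin (m + 1) => geomWeight_nonneg m k) fun f => ?_
  simp only [Function.update_self]
  refine sum_geomWeight_remaining_le hα0 hα1 hm
    (fun k => A.schedule (hardInstance M hT (Function.update f i k)) i t) ?_ ?_
  · exact fun k => (A.feasible _).nonneg i t
  · intro k k' h h'
    refine A.schedule_eq_of_not_emitted (I := hardInstance M hT (Function.update f i k))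
      (I' := hardInstance M hT (Function.update f i k')) (j := i) rfl rfl ?_ ht ?_ ?_ i
    · intro j hj
      simp only [hardInstance]
      split_ifs with hjn
      · have : (⟨j, hjn⟩ : Fin n) ≠ i := fun h => hj (congrArg Fin.val h)
        rw [Function.update_of_ne this, Function.update_of_ne this]
      · rfl
    · simpa [hardInstance_proc_coe] using h
    · simpa [hardInstance_proc_coe] using h'

/-- The expected volume of the jobs of non-maximal size. -/
noncomputable def smallMean (m : ℕ) : ℝ :=
  ∑ k : Fin (m + 1), geomWeight m k * if (k : ℕ) < m then (k : ℝ) + 1 else 0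

theorem smallMean_nonneg (m : ℕ) : 0 ≤ smallMean m :=
  Finset.sum_nonneg fun k _ => mul_nonneg (geomWeight_nonneg m k) (by split_ifs <;> positivity)

theorem sum_geomWeight_size (m : ℕ) :
    ∑ k : Fin (m + 1), geomWeight m k * ((k : ℝ) + 1) = smallMean m + (1 / 2) ^ m * (m + 1) := by
  simp [smallMean, Fin.sum_univ_castSucc, geomWeight_self]

/-- The choice of `T` cancels the mean volume of the small jobs, which leaves the volume `n 2⁻ᵐ (m +
1)` of the maximal ones; the factor `3` converts volume into a number of jobs. -/
theorem le_prodExp_unfinished (A : Algorithm α) (hα0 : 0 ≤ α) (hα1 : α ≤ 1)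
    (hm : (1 - α) * m ≤ 1) (hTn : T = n * smallMean m) {t : ℝ} (hTt : T ≤ t) (htM : t < T + M) :
    n * ((1 / 2) ^ m * (m + 1)) / 3 ≤
      prodExp (fun k : Fin (m + 1) => geomWeight m k) (fun f : Fin n → Fin (m + 1) =>
        unfinished (hardInstance M hT f) (A.schedule (hardInstance M hT f)) t) := by
  classical
  have ht : 0 ≤ t := hT.trans hTt
  have hw : ∀ k : Fin (m + 1), 0 ≤ geomWeight m k := fun k => geomWeight_nonneg m k
  have hw1 := sum_geomWeight m
  have h1 := prodExp_mono (w := fun k : Fin (m + 1) => geomWeight m k) hw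
    fun f : Fin n → Fin (m + 1) =>
      volume_sub_le_remaining (A.feasible (hardInstance M hT f)) hTt htM
  simp only [sub_eq_add_neg _ T] at h1
  rw [prodExp_add, prodExp_add, prodExp_const hw1, prodExp_sum, prodExp_sum] at h1
  simp only [prodExp_coord hw1 _ fun k : Fin (m + 1) => (k : ℝ) + 1, sum_geomWeight_size] at h1
  have h2 := Finset.sum_le_sum fun (i : Fin n) (_ : i ∈ Finset.univ) =>
    prodExp_remaining_le (M := M) (hT := hT) A hα0 hα1 hm ht i
  simp only [unfinished_hardInstance _ ht]
  rw [prodExp_add, prodExp_sum]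
  simp only [prodExp_const_mul] at h2
  rw [← Finset.mul_sum] at h2
  -- Unit jobs enter the volume bound with factor `1`; nonnegativity allows raising it to the common
  -- factor `3`.
  have h3 : 0 ≤ prodExp (fun k : Fin (m + 1) => geomWeight m k) (fun f : Fin n → Fin (m + 1) =>
      ∑ l ∈ Finset.range M, if T + (l : ℝ) ≤ t ∧
        A.schedule (hardInstance M hT f) (n + l) t < 1 then (1 : ℝ) else 0) := by
    refine (prodExp_const (ι := Fin n) hw1 0).ge.trans (prodExp_mono hw fun f => ?_)
    exact Finset.sum_nonneg fun l _ => by split_ifs <;> norm_num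
  simp only [Finset.sum_const, Finset.card_univ, Fintype.card_fin, nsmul_eq_mul] at h1
  rw [div_le_iff₀ (by norm_num)]
  linarith

/-- The average flow time of any `α`-clairvoyant algorithm on the random hard instance. -/
theorem le_sum_totalFlowTime (A : Algorithm α) (hα0 : 0 ≤ α) (hα1 : α ≤ 1)
    (hm : (1 - α) * m ≤ 1) (hTn : T = n * smallMean m) :
    ENNReal.ofReal (n * ((1 / 2) ^ m * (m + 1)) / 3) * M ≤
      ∑ f : Fin n → Fin (m + 1), ENNReal.ofReal (∏ i, geomWeight m (f i)) *
        totalFlowTime (hardInstance M hT f) (A.schedule (hardInstance M hT f)) := by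
  have hW : ∀ f : Fin n → Fin (m + 1), 0 ≤ ∏ i, geomWeight m (f i) :=
    fun f => Finset.prod_nonneg fun i _ => geomWeight_nonneg m (f i)
  have hmeas : ∀ f : Fin n → Fin (m + 1), Measurable fun t => ENNReal.ofReal
      (unfinished (hardInstance M hT f) (A.schedule (hardInstance M hT f)) t) :=
    fun f => (measurable_unfinished (A.feasible _)).ennreal_ofReal
  calc ENNReal.ofReal (n * ((1 / 2) ^ m * (m + 1)) / 3) * M
      = ∫⁻ _ in Set.Ico T (T + M), ENNReal.ofReal (n * ((1 / 2) ^ m * (m + 1)) / 3) := by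
        simp
    _ ≤ ∫⁻ t in Set.Ico T (T + M), ∑ f : Fin n → Fin (m + 1),
          ENNReal.ofReal (∏ i, geomWeight m (f i)) * ENNReal.ofReal
            (unfinished (hardInstance M hT f) (A.schedule (hardInstance M hT f)) t) := by
        refine setLIntegral_mono' measurableSet_Ico fun t ht => ?_
        refine (ENNReal.ofReal_le_ofReal
          (le_prodExp_unfinished (hT := hT) A hα0 hα1 hm hTn ht.1 ht.2)).trans ?_
        rw [prodExp]
        rw [ENNReal.ofReal_sum_of_nonneg fun f _ => mul_nonneg (hW f) (unfinished_nonneg _ _ _)]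
        exact Finset.sum_le_sum fun f _ => (ENNReal.ofReal_mul (hW f)).le
    _ = ∑ f : Fin n → Fin (m + 1), ENNReal.ofReal (∏ i, geomWeight m (f i)) *
          ∫⁻ t in Set.Ico T (T + M), ENNReal.ofReal
            (unfinished (hardInstance M hT f) (A.schedule (hardInstance M hT f)) t) := by
        rw [lintegral_finsetSum _ fun f _ => (hmeas f).const_mul _]
        exact Finset.sum_congr rfl fun f _ => lintegral_const_mul _ (hmeas f)
    _ ≤ _ := by
        gcongr with f
        exact lintegral_unfinished_le (A.feasible _) _

end HardInstance

end FlowTime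

namespace FlowTime

/-! ### Upper bounds for the optimum by uninterrupted processing -/

section NonPreemptive

/-- A job processed without interruption from time `s` on receives in `(u, t]` at most the length of
the part of its processing interval inside `(u, t]`. -/
theorem clamp_sub_clamp_le (s p : ℝ) {u t : ℝ} (hut : u ≤ t) :
    max 0 (min (t - s) p) - max 0 (min (u - s) p) ≤
      volume.real (Set.Ioc u t ∩ Set.Ioc s (s + p)) := by
  rw [Set.Ioc_inter_Ioc, Real.volume_real_Ioc]
  grind

/-- Jobs processed without interruption from the start times `s` on form a schedule. -/
theorem opt_le_of_disjoint (I : Instance) (s : ℕ → ℝ) (hs : ∀ j ∈ I.jobs, I.release j ≤ s j)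
    (hdisj : ∀ i ∈ I.jobs, ∀ j ∈ I.jobs, i < j → s i + I.proc i ≤ s j ∨ s j + I.proc j ≤ s i) :
    opt I ≤ ∑ j ∈ I.jobs, ENNReal.ofReal (s j + I.proc j - I.release j) := by
  classical
  have hy : IsSchedule I
      (fun j t => if j ∈ I.jobs then max 0 (min (t - s j) (I.proc j)) else 0) := by
    refine ⟨?_, ?_, ?_, ?_, ?_⟩
    · intro j u t hut
      dsimp only
      split_ifs
      · gcongr
      · rfl
    · intro j hj t
      simp [hj]
    · intro j hj t ht
      have := hs j hj
      simp only [hj, if_true]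
      exact max_eq_left ((min_le_left _ _).trans (by linarith))
    · intro j hj t
      simp only [hj, if_true]
      exact max_le (I.proc_pos j hj).le (min_le_right _ _)
    · intro u t hut
      calc ∑ j ∈ I.jobs, ((if j ∈ I.jobs then max 0 (min (t - s j) (I.proc j)) else 0) -
            if j ∈ I.jobs then max 0 (min (u - s j) (I.proc j)) else 0)
          ≤ ∑ j ∈ I.jobs, volume.real (Set.Ioc u t ∩ Set.Ioc (s j) (s j + I.proc j)) := by
            refine Finset.sum_le_sum fun j hj => ?_
            simp only [hj, if_true]
            exact clamp_sub_clamp_le _ _ hut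
        _ = volume.real (⋃ j ∈ I.jobs, Set.Ioc u t ∩ Set.Ioc (s j) (s j + I.proc j)) := by
            refine (measureReal_biUnion_finset ?_ ?_ ?_).symm
            · intro i hi j hj hij
              have : Disjoint (Set.Ioc (s i) (s i + I.proc i)) (Set.Ioc (s j) (s j + I.proc j)) := by
                rw [Set.disjoint_left]
                rintro x ⟨h1, h2⟩ ⟨h3, h4⟩
                rcases lt_or_gt_of_ne hij with h | h
                · rcases hdisj i hi j hj h with h' | h' <;> linarith
                · rcases hdisj j hj i hi h with h' | h' <;> linarith
              exact this.mono Set.inter_subset_right Set.inter_subset_right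
            · exact fun j _ => measurableSet_Ioc.inter measurableSet_Ioc
            · exact fun j _ => ((measure_mono Set.inter_subset_left).trans_lt
                (measure_Ioc_lt_top (a := u) (b := t))).ne
        _ ≤ volume.real (Set.Ioc u t) :=
            measureReal_mono (Set.iUnion₂_subset fun _ _ => Set.inter_subset_left)
              measure_Ioc_lt_top.ne
        _ = t - u := by rw [Real.volume_real_Ioc_of_le hut]
  refine (iInf₂_le _ hy).trans (Finset.sum_le_sum fun j hj => ?_)
  rw [ENNReal.ofReal_sub _ (I.release_nonneg j hj)]
  refine tsub_le_tsub_right (iInf₂_le _ ?_) _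
  simp [hj, (I.proc_pos j hj).le]

end NonPreemptive

section PrefixSum

variable {ι : Type*} [LinearOrder ι] {p : ι → ℝ}

theorem prefixSum_add_le (hp : ∀ i, 0 ≤ p i) (E : Finset ι) {i j : ι} (hi : i ∈ E) (hij : i < j) :
    ∑ l ∈ E with l < i, p l + p i ≤ ∑ l ∈ E with l < j, p l := by
  rw [add_comm, ← Finset.sum_insert (by simp)]
  refine Finset.sum_le_sum_of_subset_of_nonneg ?_ fun l _ _ => hp l
  intro l hl
  rcases Finset.mem_insert.1 hl with rfl | hl
  · simp [hi, hij]
  · obtain ⟨h1, h2⟩ := Finset.mem_filter.1 hl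
    exact Finset.mem_filter.2 ⟨h1, h2.trans hij⟩

theorem prefixSum_add_le_sum (hp : ∀ i, 0 ≤ p i) (E : Finset ι) {i : ι} (hi : i ∈ E) :
    ∑ l ∈ E with l < i, p l + p i ≤ ∑ l ∈ E, p l := by
  rw [add_comm, ← Finset.sum_insert (by simp)]
  refine Finset.sum_le_sum_of_subset_of_nonneg ?_ fun l _ _ => hp l
  exact Finset.insert_subset hi (Finset.filter_subset _ _)

end PrefixSum

/-! ### The optimum of the hard instance -/

section HardInstance

variable {n m M : ℕ} {T : ℝ} {hT : 0 ≤ T} {f : Fin n → Fin (m + 1)}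

/-- Processing the jobs in `D` before time `T`, then the unit jobs, and then all others. -/
theorem opt_hardInstance_le_of_subset (D : Finset (Fin n))
    (hD : ∑ i ∈ D, ((f i : ℝ) + 1) ≤ T) (hM : n * T + n * (n * ((m : ℝ) + 1)) ≤ M) :
    opt (hardInstance M hT f) ≤ ENNReal.ofReal (M * ((Dᶜ.card : ℝ) + 2)) := by
  classical
  set p : Fin n → ℝ := fun i => (f i : ℝ) + 1 with hpdef
  have hp : ∀ i, 0 ≤ p i := fun i => by positivity
  -- Start times: `D` is packed from time `0` on in index order, each unit job starts on release,
  -- and the remaining jobs are packed from `T + M` on.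
  let s : ℕ → ℝ := fun j => if h : j < n then
      (if (⟨j, h⟩ : Fin n) ∈ D then ∑ l ∈ D with l < ⟨j, h⟩, p l
        else T + M + ∑ l ∈ Dᶜ with l < ⟨j, h⟩, p l)
    else T + (j - n : ℕ)
  have hs1 : ∀ i : Fin n, i ∈ D → s i = ∑ l ∈ D with l < i, p l := by
    intro i hi; simp [s, hi]
  have hs2 : ∀ i : Fin n, i ∉ D → s i = T + M + ∑ l ∈ Dᶜ with l < i, p l := by
    intro i hi; simp [s, hi]
  have hs3 : ∀ l : ℕ, s (n + l) = T + l := by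
    intro l; simp [s]
  have hsum : ∀ (E : Finset (Fin n)) (i : Fin n), 0 ≤ ∑ l ∈ E with l < i, p l :=
    fun E i => Finset.sum_nonneg fun l _ => hp l
  have hb1 : ∀ i : Fin n, i ∈ D → s i + p i ≤ T := by
    intro i hi
    rw [hs1 i hi]
    exact (prefixSum_add_le_sum hp D hi).trans hD
  have hb2 : ∀ i : Fin n, i ∉ D → s i + p i ≤ T + M + n * ((m : ℝ) + 1) := by
    intro i hi
    rw [hs2 i hi]
    have h1 := prefixSum_add_le_sum hp Dᶜ (Finset.mem_compl.2 hi)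
    have h2 : ∑ l ∈ Dᶜ, p l ≤ ∑ l, p l :=
      Finset.sum_le_sum_of_subset_of_nonneg (Finset.subset_univ _) fun l _ _ => hp l
    have h3 : ∑ l, p l ≤ ∑ _l : Fin n, ((m : ℝ) + 1) := by
      refine Finset.sum_le_sum fun l _ => ?_
      have : ((f l : ℕ) : ℝ) ≤ m := by exact_mod_cast Nat.le_of_lt_succ (f l).2
      simp only [hpdef]
      linarith
    simp only [Finset.sum_const, Finset.card_univ, Fintype.card_fin, nsmul_eq_mul] at h3
    linarith
  have hcases : ∀ j ∈ (hardInstance M hT f).jobs, (∃ i : Fin n, j = i) ∨ ∃ l < M, j = n + l := by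
    intro j hj
    have hj : j < n + M := Finset.mem_range.1 hj
    by_cases h : j < n
    · exact Or.inl ⟨⟨j, h⟩, rfl⟩
    · exact Or.inr ⟨j - n, by omega, by omega⟩
  have hM' : ∀ l < M, ((l : ℝ) + 1) ≤ M := fun l hl => by exact_mod_cast hl
  refine (opt_le_of_disjoint _ s ?_ ?_).trans ?_
  · intro j hj
    rcases hcases j hj with ⟨i, rfl⟩ | ⟨l, hl, rfl⟩
    · rw [hardInstance_release_coe]
      by_cases hi : i ∈ D
      · rw [hs1 i hi]; exact hsum _ _
      · rw [hs2 i hi]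
        have := hsum Dᶜ i
        positivity
    · rw [hardInstance_release_add, hs3]
  · intro i hi j hj hij
    rcases hcases i hi with ⟨i, rfl⟩ | ⟨l, hl, rfl⟩ <;>
      rcases hcases j hj with ⟨j, rfl⟩ | ⟨l', hl', rfl⟩
    · have hij : i < j := hij
      simp only [hardInstance_proc_coe]
      by_cases hi : i ∈ D <;> by_cases hj : j ∈ D
      · left
        rw [hs1 i hi, hs1 j hj]
        exact prefixSum_add_le hp D hi hij
      · left
        refine (hb1 i hi).trans ?_
        rw [hs2 j hj]
        have := hsum Dᶜ j
        have : (0 : ℝ) ≤ M := by positivity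
        linarith
      · right
        refine (hb1 j hj).trans ?_
        rw [hs2 i hi]
        have := hsum Dᶜ i
        have : (0 : ℝ) ≤ M := by positivity
        linarith
      · left
        rw [hs2 i hi, hs2 j hj]
        have := prefixSum_add_le hp Dᶜ (Finset.mem_compl.2 hi) hij
        simp only [hpdef] at this ⊢
        linarith
    · rw [hardInstance_proc_coe, hardInstance_proc_add, hs3]
      by_cases hi : i ∈ D
      · left
        exact (hb1 i hi).trans (by simp)
      · right
        rw [hs2 i hi]
        have := hsum Dᶜ i
        have := hM' l' hl'
        linarith
    · omega
    · left
      rw [hardInstance_proc_add, hs3, hs3]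
      have : l + 1 ≤ l' := by omega
      have : (l : ℝ) + 1 ≤ l' := by exact_mod_cast this
      linarith
  · rw [sum_hardInstance_jobs]
    simp only [hardInstance_release_coe, hardInstance_proc_coe, hardInstance_release_add,
      hardInstance_proc_add, hs3, sub_zero]
    -- Apart from `M` for each postponed job, the old jobs cost at most `n (T + n (m + 1)) ≤ M`
    -- together. The unit jobs cost another `M`, hence the `+ 2`.
    have h1 : ∀ i : Fin n, ENNReal.ofReal (s i + ((f i : ℝ) + 1)) ≤
        ENNReal.ofReal ((T + n * ((m : ℝ) + 1)) + if i ∈ Dᶜ then (M : ℝ) else 0) := by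
      intro i
      refine ENNReal.ofReal_le_ofReal ?_
      have h0 : (0 : ℝ) ≤ n * ((m : ℝ) + 1) := by positivity
      by_cases hi : i ∈ D
      · have := hb1 i hi
        simp only [Finset.mem_compl, hi, not_true, if_false, hpdef] at this ⊢
        linarith
      · have := hb2 i hi
        simp only [Finset.mem_compl, hi, not_false_eq_true, if_true, hpdef] at this ⊢
        linarith
    have h2 : ∀ l ∈ Finset.range M, ENNReal.ofReal (T + (l : ℝ) + 1 - (T + l)) =
        ENNReal.ofReal 1 := by
      intro l _; congr 1; ring
    rw [Finset.sum_congr rfl h2]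
    refine (add_le_add_left (Finset.sum_le_sum fun i _ => h1 i) _).trans ?_
    rw [← ENNReal.ofReal_sum_of_nonneg (fun i _ => by split_ifs <;> positivity),
      ← ENNReal.ofReal_sum_of_nonneg (fun _ _ => zero_le_one),
      ← ENNReal.ofReal_add (Finset.sum_nonneg fun i _ => by split_ifs <;> positivity)
        (by simp)]
    refine ENNReal.ofReal_le_ofReal ?_
    rw [Finset.sum_add_distrib, Finset.sum_ite_mem, Finset.univ_inter]
    simp only [Finset.sum_const, Finset.card_univ, Fintype.card_fin, nsmul_eq_mul,
      Finset.card_range]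
    nlinarith

/-- The amount by which the volume of the jobs of non-maximal size exceeds its mean. -/
noncomputable def excess (f : Fin n → Fin (m + 1)) : ℝ :=
  ∑ i, ((if (f i : ℕ) < m then (f i : ℝ) + 1 else 0) - smallMean m)

/-- Every size is at least `1`, so dropping `⌈excess f⌉₊` small jobs brings the volume of the small
jobs down to `T`. If there are fewer small jobs than that, all are dropped. -/
theorem exists_subset_volume_le (hT : 0 ≤ T) (hTn : T = n * smallMean m)
    (f : Fin n → Fin (m + 1)) :
    ∃ D : Finset (Fin n), ∑ i ∈ D, ((f i : ℝ) + 1) ≤ T ∧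
      (Dᶜ.card : ℝ) ≤ ∑ i, (if (f i : ℕ) < m then 0 else 1) + (max (excess f) 0 + 1) := by
  classical
  set S : Finset (Fin n) := {i | (f i : ℕ) < m} with hS
  have hX : excess f = ∑ i ∈ S, ((f i : ℝ) + 1) - T := by
    rw [excess, Finset.sum_sub_distrib, hS, Finset.sum_filter, hTn]
    simp
  have hbig : ∑ i, (if (f i : ℕ) < m then (0 : ℝ) else 1) = (Sᶜ.card : ℝ) := by
    rw [hS, Finset.compl_filter, ← Finset.sum_boole]
    exact Finset.sum_congr rfl fun i _ => by split_ifs <;> rfl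
  have hceil : (⌈excess f⌉₊ : ℝ) ≤ max (excess f) 0 + 1 := by
    rcases le_total (excess f) 0 with h | h
    · rw [Nat.ceil_eq_zero.2 h, max_eq_right h]; simp
    · rw [max_eq_left h]; exact (Nat.ceil_lt_add_one h).le
  rw [hbig]
  have hcard : (S.card : ℝ) + Sᶜ.card = n := by
    have := Finset.card_add_card_compl S
    rw [Fintype.card_fin] at this
    exact_mod_cast this
  rcases le_total S.card ⌈excess f⌉₊ with h | h
  · refine ⟨∅, by simpa using hT, ?_⟩
    have h' : (S.card : ℝ) ≤ ⌈excess f⌉₊ := by exact_mod_cast h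
    simp only [Finset.compl_empty, Finset.card_univ, Fintype.card_fin]
    linarith
  · obtain ⟨R, hRS, hR⟩ := Finset.exists_subset_card_eq h
    refine ⟨S \ R, ?_, ?_⟩
    · have h1 := Finset.sum_sdiff (f := fun i => ((f i : ℕ) : ℝ) + 1) hRS
      have h2 : (R.card : ℝ) ≤ ∑ i ∈ R, ((f i : ℝ) + 1) := by
        rw [← nsmul_one, ← Finset.sum_const]
        exact Finset.sum_le_sum fun i _ => by simp
      have h3 := Nat.le_ceil (excess f)
      rw [← hR] at h3
      linarith
    · have h1 := Finset.card_add_card_compl (S \ R)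
      have h2 := Finset.card_sdiff_add_card_eq_card hRS
      rw [Fintype.card_fin] at h1
      have h1' : ((S \ R).card : ℝ) + (S \ R)ᶜ.card = n := by exact_mod_cast h1
      have h2' : ((S \ R).card : ℝ) + R.card = S.card := by exact_mod_cast h2
      have hR' : (R.card : ℝ) = ⌈excess f⌉₊ := by exact_mod_cast hR
      linarith

/-- The inequality `x ≤ σ + x² / (4σ)` replaces the positive part of the excess by its square, whose
mean is computable by independence. In `σ + 3`, rounding up accounts for `1` and the schedule for
`2`. -/
theorem opt_hardInstance_le (hTn : T = n * smallMean m)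
    (hM : n * T + n * (n * ((m : ℝ) + 1)) ≤ M) {σ : ℝ} (hσ : 0 < σ) :
    opt (hardInstance M hT f) ≤ ENNReal.ofReal
      (M * (∑ i, (if (f i : ℕ) < m then 0 else 1) + ((4 * σ)⁻¹ * excess f ^ 2 + (σ + 3)))) := by
  obtain ⟨D, hD, hcard⟩ := exists_subset_volume_le hT hTn f
  refine (opt_hardInstance_le_of_subset D hD hM).trans (ENNReal.ofReal_le_ofReal ?_)
  have hX : max (excess f) 0 ≤ σ + (4 * σ)⁻¹ * excess f ^ 2 := by
    refine max_le ?_ (by positivity)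
    have h : σ + (4 * σ)⁻¹ * excess f ^ 2 - excess f = (4 * σ)⁻¹ * (excess f - 2 * σ) ^ 2 := by
      field_simp
      ring
    have : 0 ≤ (4 * σ)⁻¹ * (excess f - 2 * σ) ^ 2 := by positivity
    linarith
  refine mul_le_mul_of_nonneg_left ?_ (Nat.cast_nonneg M)
  linarith

theorem prodExp_excess_sq_le (n m : ℕ) :
    prodExp (fun k : Fin (m + 1) => geomWeight m k)
      (fun f : Fin n → Fin (m + 1) => excess f ^ 2) ≤ n * 6 := by
  have hw1 : ∑ k : Fin (m + 1), geomWeight m k = 1 := sum_geomWeight m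
  have h := prodExp_sq_sum (ι := Fin n) hw1
    (fun k : Fin (m + 1) => (if (k : ℕ) < m then (k : ℝ) + 1 else 0) - smallMean m) (by
      simp only [mul_sub, Finset.sum_sub_distrib, ← Finset.sum_mul, hw1, one_mul]
      exact sub_self _)
  unfold excess
  rw [h, Fintype.card_fin]
  refine mul_le_mul_of_nonneg_left ?_ (Nat.cast_nonneg n)
  -- The variance is at most the second moment.
  have h2 : ∀ k : Fin (m + 1),
      geomWeight m k * ((if (k : ℕ) < m then (k : ℝ) + 1 else 0) - smallMean m) ^ 2 =
      geomWeight m k * (if (k : ℕ) < m then (k : ℝ) + 1 else 0) ^ 2 +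
      (geomWeight m k * (if (k : ℕ) < m then (k : ℝ) + 1 else 0) * (-2 * smallMean m) +
        geomWeight m k * smallMean m ^ 2) := by
    intro k; ring
  simp only [h2, Finset.sum_add_distrib, ← Finset.sum_mul, hw1]
  change _ + (smallMean m * (-2 * smallMean m) + 1 * smallMean m ^ 2) ≤ 6
  nlinarith [sum_geomWeight_sq_le m, sq_nonneg (smallMean m)]

/-- The average optimal flow time of the random hard instance. -/
theorem sum_opt_hardInstance_le (hTn : T = n * smallMean m)
    (hM : n * T + n * (n * ((m : ℝ) + 1)) ≤ M) {σ : ℝ} (hσ : 0 < σ) :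
    ∑ f : Fin n → Fin (m + 1), ENNReal.ofReal (∏ i, geomWeight m (f i)) *
        opt (hardInstance M hT f) ≤
      ENNReal.ofReal (M * (n * (1 / 2) ^ m + ((4 * σ)⁻¹ * (n * 6) + (σ + 3)))) := by
  have hW : ∀ f : Fin n → Fin (m + 1), 0 ≤ ∏ i, geomWeight m (f i) :=
    fun f => Finset.prod_nonneg fun i _ => geomWeight_nonneg m (f i)
  have hw1 : ∑ k : Fin (m + 1), geomWeight m k = 1 := sum_geomWeight m
  refine (Finset.sum_le_sum fun f _ =>
    mul_le_mul_right (opt_hardInstance_le hTn hM hσ) _).trans ?_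
  simp only [← ENNReal.ofReal_mul (hW _)]
  rw [← ENNReal.ofReal_sum_of_nonneg]
  · refine ENNReal.ofReal_le_ofReal ?_
    change prodExp (fun k : Fin (m + 1) => geomWeight m k) _ ≤ _
    rw [prodExp_const_mul, prodExp_add, prodExp_add, prodExp_const hw1, prodExp_const_mul,
      prodExp_sum]
    simp only [prodExp_coord hw1 _ fun k : Fin (m + 1) => if (k : ℕ) < m then (0 : ℝ) else 1]
    refine mul_le_mul_of_nonneg_left (add_le_add (le_of_eq ?_) (add_le_add_left ?_ _))
      (Nat.cast_nonneg M)
    · simp [Fin.sum_univ_castSucc, geomWeight_self]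
    · exact mul_le_mul_of_nonneg_left (prodExp_excess_sq_le n m) (by positivity)
  · intro f _
    refine mul_nonneg (hW f) (mul_nonneg (Nat.cast_nonneg M) (add_nonneg ?_ (by positivity)))
    exact Finset.sum_nonneg fun i _ => by split_ifs <;> norm_num

end HardInstance

/-! ### Yao's principle and the choice of parameters -/

/-- Averaging over finitely many instances (Yao's principle). -/
theorem RandomizedAlgorithm.IsCompetitive.le_of_forall_sum_le {α : ℝ} {Ω : Type*}
    [MeasurableSpace Ω] {A : RandomizedAlgorithm α Ω} {ρ : ℝ≥0∞} (hA : A.IsCompetitive ρ)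
    {β : Type*} (s : Finset β) (W : β → ℝ≥0∞) (I : β → Instance) {a : ℝ≥0∞}
    (h : ∀ B : Algorithm α, a ≤ ∑ b ∈ s, W b * totalFlowTime (I b) (B.schedule (I b))) :
    a ≤ ρ * ∑ b ∈ s, W b * opt (I b) := by
  have := A.isProbabilityMeasure
  calc a = ∫⁻ _, a ∂A.law := by simp
    _ ≤ ∫⁻ ω, ∑ b ∈ s, W b * totalFlowTime (I b) ((A.alg ω).schedule (I b)) ∂A.law :=
        lintegral_mono fun ω => h (A.alg ω)
    _ = ∑ b ∈ s, W b * A.expectedFlowTime (I b) := by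
        rw [lintegral_finsetSum _ fun b _ => (A.measurable_flow (I b)).const_mul _]
        exact Finset.sum_congr rfl fun b _ => lintegral_const_mul _ (A.measurable_flow (I b))
    _ ≤ ∑ b ∈ s, W b * (ρ * opt (I b)) := by
        gcongr with b
        exact hA (I b)
    _ = ρ * ∑ b ∈ s, W b * opt (I b) := by
        rw [Finset.mul_sum]
        exact Finset.sum_congr rfl fun b _ => mul_left_comm _ _ _

theorem RandomizedAlgorithm.IsCompetitive.div_le {α : ℝ} (hα0 : 0 ≤ α) (hα1 : α < 1) {Ω : Type*}
    [MeasurableSpace Ω] {A : RandomizedAlgorithm α Ω} {ρ : ℝ≥0∞} (hA : A.IsCompetitive ρ) :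
    ENNReal.ofReal (1 / 12 / (1 - α)) ≤ ρ := by
  have hε : 0 < 1 - α := sub_pos.2 hα1
  set m : ℕ := ⌊1 / (1 - α)⌋₊ with hmdef
  have hm : (1 - α) * m ≤ 1 := by
    have := Nat.floor_le (one_div_pos.2 hε).le
    rw [le_div_iff₀ hε] at this
    rw [mul_comm]
    exact this
  have hm' : 1 / (1 - α) ≤ m + 1 := (Nat.lt_floor_add_one _).le
  -- This makes `√n = 2 · 2ᵐ` comparable to the expected number `n 2⁻ᵐ = 4 · 2ᵐ` of maximal jobs.
  set n : ℕ := 4 ^ (m + 1) with hn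
  set T : ℝ := n * smallMean m with hTn
  have hT : 0 ≤ T := mul_nonneg (Nat.cast_nonneg n) (smallMean_nonneg m)
  obtain ⟨M, hM⟩ := exists_nat_ge (n * T + n * (n * ((m : ℝ) + 1)) + 1)
  have hMpos : (0 : ℝ) < M := lt_of_lt_of_le (by positivity) hM
  have key := hA.le_of_forall_sum_le Finset.univ
    (fun f : Fin n → Fin (m + 1) => ENNReal.ofReal (∏ i, geomWeight m (f i)))
    (fun f => hardInstance M hT f) fun B => le_sum_totalFlowTime B hα0 hα1.le hm hTn
  -- `σ = 2 ^ m` is of the order of `√n`, the standard deviation bound for the excess.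
  replace key := key.trans (mul_le_mul_right (sum_opt_hardInstance_le (hT := hT) hTn
    (by linarith) (show (0 : ℝ) < 2 ^ m by positivity)) ρ)
  have hpow : (1 : ℝ) ≤ 2 ^ m := one_le_pow₀ (by norm_num)
  have hn' : (n : ℝ) = 4 * 2 ^ m * 2 ^ m := by
    rw [hn, pow_succ]
    push_cast
    rw [show (4 : ℝ) = 2 * 2 by norm_num, mul_pow]
    ring
  have hhalf : ((1 : ℝ) / 2) ^ m = (2 ^ m)⁻¹ := by rw [one_div, inv_pow]
  set P : ℝ := 2 ^ m with hP
  have hB : (n : ℝ) * (1 / 2) ^ m = 4 * P := by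
    rw [hhalf, hn']; field_simp
  -- With `P = 2 ^ m` the bracket is `4P + 6P + P + 3 ≤ 14P`. Against the algorithm's `4P (m + 1) /
  -- 3`, the rounder `16P` gives the ratio `(m + 1) / 12`.
  have hright : (M : ℝ) * (n * (1 / 2) ^ m + ((4 * P)⁻¹ * (n * 6) + (P + 3))) ≤ M * (16 * P) := by
    refine mul_le_mul_of_nonneg_left ?_ hMpos.le
    have : (4 * P)⁻¹ * (n * 6) = 6 * P := by rw [hn']; field_simp
    rw [hB, this]
    linarith
  have hc : 0 < (M : ℝ) * (16 * P) := by positivity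
  have hleft : ENNReal.ofReal (1 / 12 / (1 - α)) * ENNReal.ofReal (M * (16 * P)) ≤
      ENNReal.ofReal (n * ((1 / 2) ^ m * (m + 1)) / 3) * M := by
    rw [← ENNReal.ofReal_natCast M, ← ENNReal.ofReal_mul (by positivity),
      ← ENNReal.ofReal_mul (by positivity)]
    refine ENNReal.ofReal_le_ofReal ?_
    rw [← mul_assoc (n : ℝ), hB]
    calc 1 / 12 / (1 - α) * (M * (16 * P)) = 1 / (1 - α) * (M * (4 * P) / 3) := by ring
      _ ≤ (m + 1) * (M * (4 * P) / 3) := by gcongr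
      _ = _ := by ring
  have := hleft.trans (key.trans (mul_le_mul_right (ENNReal.ofReal_le_ofReal hright) ρ))
  exact (ENNReal.mul_le_mul_iff_left (ENNReal.ofReal_pos.2 hc).ne' ENNReal.ofReal_ne_top).1 this

end FlowTime

theorem theorem2 :
    ∃ c : ℝ, 0 < c ∧
      ∀ α : ℝ, 0 ≤ α → α < 1 →
        ∀ (Ω : Type*) [MeasurableSpace Ω] (A : FlowTime.RandomizedAlgorithm α Ω),
          ENNReal.ofReal (c / (1 - α)) ≤ A.competitiveRatio := by
  refine ⟨1 / 12, by norm_num, fun α hα0 hα1 Ω _ A => ?_⟩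
  exact le_sInf fun ρ hρ => FlowTime.RandomizedAlgorithm.IsCompetitive.div_le hα0 hα1 hρ
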